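/- **Definitions.** A *virtual link diagram* $D$ is a closed 1-manifold generically immersed in the oriented plane $\mathbb{R}^2$ (possibly empty, finitely many components) in which each double point is labelled either as a real crossing, with over/under information, or as a virtual crossing. A *virtual link* is an equivalence class of virtual link diagrams under plane isotopy and the generalised Reidemeister moves: the classical moves I, II, III, the virtual moves I, II, III (the same moves with virtual crossings only), and the mixed move III, in which a strand with two virtual crossings is moved past a real crossing. A *checkerboard coloring* of $D$ chooses, along each strand, a side that is colored near the strand, such that at each real crossing the coloring alternates (exactly one of the two pairs of opposite quadrants is colored), while at a virtual crossing each of the two strands keeps its colored side, independently of the other strand. A virtual link is *checkerboard colorable* if at least one of its diagrams has a checkerboard coloring. A *signed cyclic graph* $G$ is a finite graph (loops, multiple edges, isolated vertices and several components are allowed) with a cyclic ordering, regarded as counterclockwise, of the half-edges at each vertex and with a sign $+$ or $-$ on each edge; equivalently, it is a signed orientable ribbon graph with an orientation. Its *medial link diagram* is the following link diagram on the oriented surface of this ribbon graph. It has one crossing on each edge. For any half-edges $h$ and $h'$ such that $h'$ follows $h$ counterclockwise at a vertex, it has an arc along that corner of the vertex, from the counterclockwise side of $h$ to the clockwise side of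 $h'$; round each isolated vertex it has a crossingless circle. At the crossing on a positive edge the over strand is the one that, when turned counterclockwise, sweeps out the two quadrants containing the edge (so the $A$-smoothing joins these two quadrants and the $B$-smoothing separates them); at the crossing on a negative edge the other strand is the over strand. A virtual link diagram is *associated with* $G$ if it is obtained from the medial link diagram of $G$ by a generic orientation-preserving immersion of a neighbourhood of that diagram into the plane, the new double points being marked as virtual crossings. In other words, the real crossings of the virtual diagram, with the counterclockwise order of their four ends and the over strands, the arcs joining these ends through virtual crossings, and the components without real crossings correspond bijectively to those of the medial link diagram. A virtual link is *graphical* if it is represented by a virtual link diagram associated with some signed cyclic graph. **Theorem.** A virtual link $L$ is graphical if and only if it is checkerboard colorable. -/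

import Mathlib

/-! Virtual link diagrams, generalised Reidemeister moves, checkerboard colourings,
signed cyclic graphs and their medial link diagrams. -/

namespace VirtualLinks

/-! ### Virtual link diagrams

A generic closed plane curve system is cut by horizontal lines into slices, each of which contains
exactly one minimum, maximum or double point, all other strands running straight upwards.
A diagram is recorded by its list of slices, from bottom to top. -/

/-- The type of a double point. At a real crossing the parameter says which strand is the over
strand: `true` for the one running from south-west to north-east (`/`), `false` for the one running
from south-east to north-west. -/
inductive Crossing
  | real (slash : Bool)
  | virt

/-- The crossing seen after a quarter turn of the plane; for a real crossing this exchanges the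
two kinds. -/
def Crossing.turn : Crossing → Crossing
  | .real t => .real (!t)
  | .virt => .virt

/-- The singular point contained in a slice: a minimum, a maximum or a double point. -/
inductive Piece
  | cup
  | cap
  | cross (x : Crossing)

/-- The number of strands entering a piece from below. -/
def Piece.src : Piece → ℕ
  | .cup => 0
  | .cap => 2
  | .cross _ => 2

/-- The number of strands leaving a piece at the top. -/
def Piece.tgt : Piece → ℕ
  | .cup => 2
  | .cap => 0
  | .cross _ => 2

/-- A horizontal slice of a diagram: one piece, with `left` vertical strands to the left of it and
`right` vertical strands to the right of it. -/
structure Slice where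
  left : ℕ
  piece : Piece
  right : ℕ

/-- The number of strands at the bottom of a slice. -/
def Slice.src (s : Slice) : ℕ := s.left + s.piece.src + s.right

/-- The number of strands at the top of a slice. -/
def Slice.tgt (s : Slice) : ℕ := s.left + s.piece.tgt + s.right

/-- The slices of `w` can be stacked, starting with `m` strands and ending with `n` strands. -/
def Stackable : ℕ → List Slice → ℕ → Prop
  | m, [], n => m = n
  | m, s :: w, n => s.src = m ∧ Stackable s.tgt w n

/-- A virtual link diagram in the plane (in general position with respect to the height). -/
structure Diagram where
  word : List Slice
  closed : Stackable 0 word 0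

/-- The admissible crossing types in a triangle move. With three strands `a, b, c` (numbered from
left to right at the bottom), `x, y, z` are the crossings of `a` with `b`, of `a` with `c` and of
`b` with `c`. Three real crossings must not be cyclically over one another; three virtual
crossings, or one real and two virtual crossings, are always allowed; two real crossings and one
virtual crossing (the forbidden moves) never are. -/
def TriangleAdmissible : Crossing → Crossing → Crossing → Prop
  | .real a, .real b, .real c => b = a ∨ b = c
  | .virt, .virt, .virt => True
  | .real _, .virt, .virt => True
  | .virt, .real _, .virt => True
  | .virt, .virt, .real _ => True
  | _, _, _ => False

/-- The local moves on pieces of diagrams: plane isotopies (`commute`, `zigzag`, `zigzag'`,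
`slideCap`, `slideCup`) and the generalised Reidemeister moves, real, virtual and mixed
(`kinkCap`, `kinkCup`, `bigon`, `triangle`). -/
inductive Move : List Slice → List Slice → Prop
  /-- Two pieces that lie side by side may exchange their heights. -/
  | commute (l m r : ℕ) (p q : Piece) :
      Move [⟨l, p, m + q.src + r⟩, ⟨l + p.tgt + m, q, r⟩]
        [⟨l + p.src + m, q, r⟩, ⟨l, p, m + q.tgt + r⟩]
  /-- A minimum followed by a maximum on the same strand cancels. -/
  | zigzag (l r : ℕ) : Move [⟨l + 1, .cup, r⟩, ⟨l, .cap, r + 1⟩] []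
  | zigzag' (l r : ℕ) : Move [⟨l, .cup, r + 1⟩, ⟨l + 1, .cap, r⟩] []
  /-- A double point is rotated past a maximum. -/
  | slideCap (l r : ℕ) (x : Crossing) :
      Move [⟨l + 1, .cross x, r⟩, ⟨l, .cap, r + 1⟩]
        [⟨l, .cross x.turn, r + 1⟩, ⟨l + 1, .cap, r⟩]
  /-- A double point is rotated past a minimum. -/
  | slideCup (l r : ℕ) (x : Crossing) :
      Move [⟨l, .cup, r + 1⟩, ⟨l + 1, .cross x, r⟩]
        [⟨l + 1, .cup, r⟩, ⟨l, .cross x.turn, r + 1⟩]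
  /-- First Reidemeister move, real and virtual: a kink is removed. -/
  | kinkCap (l r : ℕ) (x : Crossing) :
      Move [⟨l, .cross x, r⟩, ⟨l, .cap, r⟩] [⟨l, .cap, r⟩]
  | kinkCup (l r : ℕ) (x : Crossing) :
      Move [⟨l, .cup, r⟩, ⟨l, .cross x, r⟩] [⟨l, .cup, r⟩]
  /-- Second Reidemeister move, real and virtual. -/
  | bigon (l r : ℕ) (x : Crossing) :
      Move [⟨l, .cross x, r⟩, ⟨l, .cross x.turn, r⟩] []
  /-- Third Reidemeister move, real, virtual and mixed. -/
  | triangle (l r : ℕ) (x y z : Crossing) (h : TriangleAdmissible x y z) :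
      Move [⟨l, .cross x, r + 1⟩, ⟨l + 1, .cross y, r⟩, ⟨l, .cross z, r + 1⟩]
        [⟨l + 1, .cross z, r⟩, ⟨l, .cross y, r + 1⟩, ⟨l + 1, .cross x, r⟩]

/-- `D'` arises from `D` by a single local move. -/
def Diagram.Step (D D' : Diagram) : Prop :=
  ∃ u a b v, Move a b ∧ D.word = u ++ a ++ v ∧ D'.word = u ++ b ++ v

/-- A virtual link: an equivalence class of virtual link diagrams, for the equivalence relation
generated by plane isotopy and the generalised Reidemeister moves. -/
def VirtualLink : Type := Quot Diagram.Step

/-- The virtual link represented by a diagram. -/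
def Diagram.link (D : Diagram) : VirtualLink := Quot.mk _ D

/-! ### Checkerboard colourings

The place `(k, i)` of a diagram is the point where the `i`-th strand (from the left, from `0`)
meets the horizontal line below the `k`-th slice, which is also the line above slice `k - 1`. -/

/-- The conditions on a checkerboard colouring in the `k`-th slice. Here `c k i = true` if, near
the place `(k, i)`, the left-hand side of the strand (seen looking upwards) is coloured, and
`c k i = false` if the right-hand side is.
At a minimum or maximum the coloured side is carried along, so that left and right are exchanged.
At a real crossing either the western and eastern quadrants are coloured, or the northern and
southern ones. At a virtual crossing each strand keeps its coloured side. -/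
def ColoursSlice (c : ℕ → ℕ → Bool) (k : ℕ) (s : Slice) : Prop :=
  (∀ i < s.left, c (k + 1) i = c k i) ∧
  (∀ j < s.right, c (k + 1) (s.left + s.piece.tgt + j) = c k (s.left + s.piece.src + j)) ∧
  match s.piece with
  | .cup => c (k + 1) s.left ≠ c (k + 1) (s.left + 1)
  | .cap => c k s.left ≠ c k (s.left + 1)
  | .cross .virt => c (k + 1) (s.left + 1) = c k s.left ∧ c (k + 1) s.left = c k (s.left + 1)
  | .cross (.real _) => c k s.left ≠ c k (s.left + 1) ∧
      c (k + 1) s.left = c k s.left ∧ c (k + 1) (s.left + 1) = c k (s.left + 1)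

/-- The diagram admits a checkerboard colouring. -/
def Diagram.CheckerboardColorable (D : Diagram) : Prop :=
  ∃ c : ℕ → ℕ → Bool, ∀ k s, D.word[k]? = some s → ColoursSlice c k s

/-- A virtual link is checkerboard colourable if some diagram of it is. -/
def VirtualLink.CheckerboardColorable (L : VirtualLink) : Prop :=
  ∃ D : Diagram, D.link = L ∧ D.CheckerboardColorable

/-! ### Link diagrams on oriented surfaces -/

/-- The combinatorial data of a link diagram on an oriented surface (an abstract link diagram),
that is, of the diagram together with an oriented neighbourhood of it in the surface. -/
structure SurfaceDiagram where
  /-- The ends of arcs at crossings, four for each crossing. -/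
  End : Type
  /-- The next end counterclockwise around the same crossing. -/
  rot : End → End
  /-- The end belongs to the over strand of its crossing. -/
  isOver : End → Prop
  /-- The two ends are the two different ends of one arc. -/
  join : End → End → Prop
  /-- The components without crossings. -/
  Loop : Type

/-- An isomorphism of link diagrams on oriented surfaces: an orientation preserving homeomorphism
of neighbourhoods that respects crossings and arcs. -/
structure SurfaceDiagram.Iso (A B : SurfaceDiagram) where
  ends : A.End ≃ B.End
  loops : A.Loop ≃ B.Loop
  map_rot : ∀ x, ends (A.rot x) = B.rot (ends x)
  map_over : ∀ x, B.isOver (ends x) ↔ A.isOver x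
  map_join : ∀ x y, B.join (ends x) (ends y) ↔ A.join x y

/-- The four ends at a crossing, named by compass directions. -/
inductive Corner
  | nw | sw | se | ne

/-- The next end counterclockwise. -/
def Corner.rot : Corner → Corner
  | .nw => .sw
  | .sw => .se
  | .se => .ne
  | .ne => .nw

/-- A real crossing of a diagram. -/
structure Diagram.RealCrossing (D : Diagram) where
  level : ℕ
  left : ℕ
  slash : Bool
  right : ℕ
  get : D.word[level]? = some ⟨left, .cross (.real slash), right⟩

/-- The place of the diagram at which an end of a real crossing lies. -/
def Diagram.RealCrossing.place {D : Diagram} (x : D.RealCrossing) : Corner → ℕ × ℕ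
  | .nw => (x.level + 1, x.left)
  | .sw => (x.level, x.left)
  | .se => (x.level, x.left + 1)
  | .ne => (x.level + 1, x.left + 1)

/-- The end of a real crossing at the given corner lies on the over strand. -/
def Diagram.RealCrossing.IsOver {D : Diagram} (x : D.RealCrossing) : Corner → Prop
  | .nw => x.slash = false
  | .sw => x.slash = true
  | .se => x.slash = false
  | .ne => x.slash = true

/-- The place lies on the diagram. (No strand meets the line above the last slice.) -/
def Diagram.IsPlace (D : Diagram) (p : ℕ × ℕ) : Prop :=
  ∃ s, D.word[p.1]? = some s ∧ p.2 < s.src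

/-- Two places are joined by a strand inside a single slice; strands run straight through virtual
crossings and stop at real crossings. -/
inductive Diagram.Linked (D : Diagram) : ℕ × ℕ → ℕ × ℕ → Prop
  | left {k s i} (h : D.word[k]? = some s) (hi : i < s.left) : Linked D (k, i) (k + 1, i)
  | right {k s j} (h : D.word[k]? = some s) (hj : j < s.right) :
      Linked D (k, s.left + s.piece.src + j) (k + 1, s.left + s.piece.tgt + j)
  | cup {k l r} (h : D.word[k]? = some ⟨l, .cup, r⟩) : Linked D (k + 1, l) (k + 1, l + 1)
  | cap {k l r} (h : D.word[k]? = some ⟨l, .cap, r⟩) : Linked D (k, l) (k, l + 1)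
  | virt {k l r} (h : D.word[k]? = some ⟨l, .cross .virt, r⟩) :
      Linked D (k, l) (k + 1, l + 1)
  | virt' {k l r} (h : D.word[k]? = some ⟨l, .cross .virt, r⟩) :
      Linked D (k, l + 1) (k + 1, l)

/-- The arc (running between real crossings, through virtual crossings) that contains a place. -/
def Diagram.arc (D : Diagram) (p : ℕ × ℕ) : Quot D.Linked := Quot.mk _ p

/-- The link diagram carried by an oriented surface neighbourhood of a virtual link diagram, in
which a virtual crossing is not a crossing but a place where two bands pass each other. -/
def Diagram.surface (D : Diagram) : SurfaceDiagram where
  End := D.RealCrossing × Corner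
  rot x := (x.1, x.2.rot)
  isOver x := x.1.IsOver x.2
  join x y := x ≠ y ∧ D.arc (x.1.place x.2) = D.arc (y.1.place y.2)
  Loop := {a : Quot D.Linked // (∃ p, D.IsPlace p ∧ D.arc p = a) ∧
    ∀ (x : D.RealCrossing) (q : Corner), D.arc (x.place q) ≠ a}

/-! ### Signed cyclic graphs and the medial construction -/

/-- A finite signed cyclic graph, equivalently a signed orientable ribbon graph with a chosen
orientation. Loops, multiple edges, isolated vertices and disconnected graphs are allowed. -/
structure SignedCyclicGraph where
  /-- Vertices. -/
  V : Type
  /-- Half-edges. -/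
  H : Type
  finite_V : Finite V
  finite_H : Finite H
  /-- The vertex of a half-edge. -/
  root : H → V
  /-- The other half of the same edge. -/
  flip : H → H
  flip_flip : ∀ h, flip (flip h) = h
  flip_ne : ∀ h, flip h ≠ h
  /-- The next half-edge, counterclockwise, at the same vertex. -/
  next : Equiv.Perm H
  /-- The half-edges at a vertex form exactly one cycle. -/
  sameCycle_iff : ∀ h h', next.SameCycle h h' ↔ root h = root h'
  /-- The sign of the edge of a half-edge; `true` is `+`. -/
  sign : H → Bool
  sign_flip : ∀ h, sign (flip h) = sign h

/-- The medial link diagram of a signed cyclic graph on its surface.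

There is one crossing for each edge, with an end on either side of each of its two half-edges:
`(h, true)` is on the counterclockwise side of `h`, `(h, false)` on the clockwise side, with
respect to the rotation at the vertex of `h`. So, with `g = G.flip h`, the ends met in
counterclockwise order are `(h, true)`, `(h, false)`, `(g, true)`, `(g, false)`, and the edge runs
through the quadrants between `(h, true)` and `(h, false)` and between `(g, true)` and
`(g, false)`. The arcs run along the corners of the vertices, from the counterclockwise side of a
half-edge to the clockwise side of the next one, and round each isolated vertex there is a circle.

For a positive edge the over strand is the one with the ends `(h, true)`, `(g, true)`: turning it
counterclockwise sweeps out the quadrants that contain the edge, so that the `A`-smoothing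
joins these quadrants and the `B`-smoothing separates them. For a negative edge the other strand
is the over strand. -/
def SignedCyclicGraph.medial (G : SignedCyclicGraph) : SurfaceDiagram where
  End := G.H × Bool
  rot
    | (h, true) => (h, false)
    | (h, false) => (G.flip h, true)
  isOver x := x.2 = G.sign x.1
  join x y := ∃ h, (x = (h, true) ∧ y = (G.next h, false)) ∨
    (y = (h, true) ∧ x = (G.next h, false))
  Loop := {v : G.V // ∀ h, G.root h ≠ v}

/-- The virtual link diagram `D` is associated with `G`: it is obtained from the medial link
diagram of `G` by immersing it, with its neighbourhood in the surface, into the oriented plane and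
marking the new double points as virtual. -/
def Diagram.IsAssociatedWith (D : Diagram) (G : SignedCyclicGraph) : Prop :=
  Nonempty (G.medial.Iso D.surface)

/-- A virtual link is graphical if it is represented by a virtual link diagram associated with
some signed cyclic graph. -/
def VirtualLink.Graphical (L : VirtualLink) : Prop :=
  ∃ (G : SignedCyclicGraph) (D : Diagram), D.IsAssociatedWith G ∧ D.link = L

end VirtualLinks

namespace VirtualLinks

/-! ### Pairs of involutions -/

/-! Both properties of a link ask for a single diagram, so it suffices to show that a fixed diagram
is colourable exactly when it is associated with some graph; Reidemeister moves play no part. Direct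
each end of an arc at a real crossing away from the crossing and record whether the coloured side is
on its left. These values alternate around every crossing, and they differ at the two ends of an arc
because the directions there are opposite. Such a colouring of ends (`AlternatesOnEnds`), with a
unique partner for each end, is equivalent both to a checkerboard colouring and to a graph whose
medial diagram is the given one: an end of value `true` has a coloured quadrant on its
counterclockwise side. These quadrants are the half-edges, and following arcs along the coloured
side yields the vertices. Conversely the medial ends `(h, b)` are coloured by `b`. Arcs are handled
as orbits of two involutions on ports (`Port.arc_eq_iff`): `across` runs through a slice and stops
at real crossings, `turn` passes to the neighbouring slice. That an arc has exactly two ends is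
deduced from the colouring (`exists_opposite_fixed`) or from the medial diagram. Extending a
colouring of ends along arcs and to closed components uses `exists_alternating_of_involutive`. -/

theorem exists_alternating_of_involutive {X : Type*} {σ τ : X → X}
    (hσ : Function.Involutive σ) (hτ : Function.Involutive τ)
    (hσ' : ∀ x, σ x ≠ x) (hτ' : ∀ x, τ x ≠ x) :
    ∃ C : X → Bool, (∀ x, C (τ x) = !C x) ∧ ∀ x, C (σ x) = !C x := by
  classical
  let s : Equiv.Perm X := hσ.toPerm
  let t : Equiv.Perm X := hτ.toPerm
  have hs : s * s = 1 := by ext x; exact hσ x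
  have ht : t * t = 1 := by ext x; exact hτ x
  have ht' : t⁻¹ = t := inv_eq_of_mul_eq_one_left ht
  have hs' : s⁻¹ = s := inv_eq_of_mul_eq_one_left hs
  have conj_t : ∀ n : ℤ, t * (s * t) ^ n = (s * t) ^ (-n) * t := by
    intro n
    have h : t * (s * t) * t⁻¹ = (s * t)⁻¹ := by
      rw [mul_inv_rev, hs', ht']; simp [mul_assoc, ht]
    have h2 := conj_zpow (i := n) (a := t) (b := s * t)
    rw [h, inv_zpow'] at h2
    rw [h2]; simp
  have conj_s : ∀ n : ℤ, s * (s * t) ^ n = (s * t) ^ (-n) * s := by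
    intro n
    have h : s * (s * t) * s⁻¹ = (s * t)⁻¹ := by
      rw [mul_inv_rev, hs', ht', ← mul_assoc, hs, one_mul]
    have h2 := conj_zpow (i := n) (a := s) (b := s * t)
    rw [h, inv_zpow'] at h2
    rw [h2]; simp
  -- If `(s * t) ^ n` takes `x` to `t x`, the midpoint of this path is fixed by `t` for even `n` and
  -- by `s` for odd `n`.
  have free : ∀ x, ¬ (s * t).SameCycle x (t x) := by
    rintro x ⟨n, hn⟩
    obtain ⟨k, rfl⟩ | ⟨k, rfl⟩ := n.even_or_odd
    · apply hτ' (((s * t) ^ k) x)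
      change (t * (s * t) ^ k) x = _
      rw [conj_t, Equiv.Perm.mul_apply, ← hn, ← Equiv.Perm.mul_apply, ← zpow_add]
      congr 2; ring
    · apply hσ' (((s * t) ^ (k + 1)) x)
      change (s * (s * t) ^ (k + 1)) x = _
      have e : s x = (s * t) (t x) := by
        rw [← Equiv.Perm.mul_apply, mul_assoc, ht, mul_one]
      rw [conj_s, Equiv.Perm.mul_apply, e, ← hn, ← Equiv.Perm.mul_apply, ← Equiv.Perm.mul_apply,
        mul_assoc, ← zpow_one_add, ← zpow_add]
      congr 2; ring
  let Q := Quotient (Equiv.Perm.SameCycle.setoid (s * t))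
  let q : X → Q := Quotient.mk _
  have hq : ∀ x y, q x = q y ↔ (s * t).SameCycle x y := fun x y => Quotient.eq
  let u : Q → Q := Quotient.map' t (by
    rintro x y ⟨n, rfl⟩
    refine ⟨-n, ?_⟩
    rw [← Equiv.Perm.mul_apply, ← Equiv.Perm.mul_apply, conj_t])
  have hu : ∀ x, u (q x) = q (t x) := fun x => rfl
  -- The map `u` exchanges cycles of `s * t` in pairs; an arbitrary order selects one cycle from
  -- each pair.
  let : LinearOrder Q := linearOrderOfSTO WellOrderingRel
  have key : ∀ x, decide (q (t x) < u (q (t x))) = !decide (q x < u (q x)) := by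
    intro x
    have h1 : u (q (t x)) = q x := by rw [hu]; exact congrArg q (hτ x)
    have h2 : q x ≠ q (t x) := fun h => free x ((hq _ _).1 h)
    rw [h1, hu]
    rcases lt_or_gt_of_ne h2 with h | h <;> simp [h, h.le]
  refine ⟨fun x => decide (q x < u (q x)), key, fun x => ?_⟩
  have : q (σ x) = q (t x) := by
    refine ((hq _ _).2 ⟨1, ?_⟩).symm
    rw [zpow_one, ← Equiv.Perm.mul_apply, mul_assoc, ht, mul_one]; rfl
  simp only [this]
  exact key x

/-- The orbit of a fixed point of `σ` is a path, walked by alternating `τ` and `σ` until `σ` fixes a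
point again. The colour changes at each step and `τ` is used once more than `σ`, so the two ends
have opposite colours. -/
theorem exists_opposite_fixed {X : Type*} [Finite X] {σ τ : X → X}
    (hσ : Function.Involutive σ) (hτ : Function.Involutive τ) {C : X → Bool}
    (hCτ : ∀ x, C (τ x) = !C x) (hCσ : ∀ x, σ x ≠ x → C (σ x) = !C x) {x : X} (hx : σ x = x) :
    ∃ y, Relation.ReflTransGen (fun a b => b = σ a ∨ b = τ a) x y ∧ σ y = y ∧ C y = !C x ∧
      ∀ z, Relation.ReflTransGen (fun a b => b = σ a ∨ b = τ a) x z → σ z = z →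
        z = x ∨ z = y := by
  classical
  let p : Equiv.Perm X := hτ.toPerm * hσ.toPerm
  have hp : ∀ a, p a = τ (σ a) := fun a => rfl
  let z : ℕ → X := fun n => (p ^ n) (τ x)
  have z0 : z 0 = τ x := rfl
  have zs : ∀ n, z (n + 1) = τ (σ (z n)) := by
    intro n; simp only [z, pow_succ', Equiv.Perm.mul_apply, hp]
  -- Since `p` has finite order the walk returns to `τ x`; the point just before is then `x`, which
  -- is fixed.
  have ex : ∃ n, σ (z n) = z n := by
    obtain ⟨N, hN⟩ : ∃ N, orderOf p = N + 1 := ⟨orderOf p - 1, by have := orderOf_pos p; omega⟩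
    have h : z (N + 1) = τ x := by simp only [z, ← hN, pow_orderOf_eq_one]; rfl
    rw [zs] at h
    refine ⟨N, ?_⟩
    have h2 := hτ.injective h
    rw [h2, ← hx, ← h2, hσ]
  let n := Nat.find ex
  have hn : σ (z n) = z n := Nat.find_spec ex
  have hmin : ∀ m < n, σ (z m) ≠ z m := fun m hm => Nat.find_min ex hm
  have hC : ∀ m ≤ n, C (z m) = !C x := by
    intro m
    induction m with
    | zero => intro _; rw [z0, hCτ]
    | succ m ih =>
      intro hm
      rw [zs, hCτ, hCσ _ (hmin m (by omega)), ih (by omega), Bool.not_not]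
  have hR : ∀ m, Relation.ReflTransGen (fun a b => b = σ a ∨ b = τ a) x (z m) := by
    intro m
    induction m with
    | zero => exact .single (Or.inr rfl)
    | succ m ih => exact (ih.tail (Or.inl rfl)).tail (Or.inr (zs m))
  refine ⟨z n, hR n, hn, hC n le_rfl, fun w hw hfix => ?_⟩
  -- The points already met on the walk are closed under both involutions.
  have hT : ∃ m ≤ n, w = z m ∨ w = τ (z m) := by
    clear hfix
    induction hw with
    | refl => exact ⟨0, n.zero_le, Or.inr (by rw [z0, hτ])⟩
    | tail _ hbc ih =>
      obtain ⟨m, hm, rfl | rfl⟩ := ih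
      · rcases hbc with rfl | rfl
        · rcases hm.lt_or_eq with h | h
          · exact ⟨m + 1, h, Or.inr (by rw [zs, hτ])⟩
          · exact ⟨m, hm, Or.inl (by rw [h, hn])⟩
        · exact ⟨m, hm, Or.inr rfl⟩
      · rcases hbc with rfl | rfl
        · cases m with
          | zero => exact ⟨0, n.zero_le, Or.inr (by rw [z0, hτ, hx])⟩
          | succ m => exact ⟨m, by omega, Or.inl (by rw [zs, hτ, hσ])⟩
        · exact ⟨m, hm, Or.inl (hτ _)⟩
  obtain ⟨m, hm, rfl | rfl⟩ := hT
  · rcases hm.lt_or_eq with h | h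
    · exact absurd hfix (hmin m h)
    · exact Or.inr (by rw [h])
  · cases m with
    | zero => exact Or.inl (by rw [z0, hτ])
    | succ m =>
      rw [zs, hτ, hσ] at hfix
      exact absurd hfix.symm (hmin m (by omega))

/-! ### Ports of slices and diagrams -/

/-- A strand enters or leaves the slice at this position: `(i, true)` is the `i`-th strand on the
bottom line, `(i, false)` the `i`-th strand on the top line. -/
def Slice.IsPort (s : Slice) : ℕ × Bool → Prop
  | (i, true) => i < s.src
  | (i, false) => i < s.tgt

/-- The other port of the strand of a slice; a port at a real crossing is left fixed. -/
def Slice.across (s : Slice) : ℕ × Bool → ℕ × Bool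
  | (i, true) =>
    if i < s.left then (i, false)
    else if i < s.left + s.piece.src then
      match s.piece with
      | .cap => if i = s.left then (s.left + 1, true) else (s.left, true)
      | .cross .virt => if i = s.left then (s.left + 1, false) else (s.left, false)
      | _ => (i, true)
    else (i - s.piece.src + s.piece.tgt, false)
  | (i, false) =>
    if i < s.left then (i, true)
    else if i < s.left + s.piece.tgt then
      match s.piece with
      | .cup => if i = s.left then (s.left + 1, false) else (s.left, false)
      | .cross .virt => if i = s.left then (s.left + 1, true) else (s.left, true)
      | _ => (i, false)
    else (i - s.piece.tgt + s.piece.src, true)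

theorem Slice.isPort_across {s : Slice} {p : ℕ × Bool} (h : s.IsPort p) :
    s.IsPort (s.across p) := by
  obtain ⟨l, q, r⟩ := s
  obtain ⟨i, _ | _⟩ := p <;> obtain _ | _ | ⟨_ | _⟩ := q <;>
    grind [Slice.IsPort, Slice.across, Slice.src, Slice.tgt, Piece.src, Piece.tgt]

theorem Slice.across_across (s : Slice) : Function.Involutive s.across := by
  intro p
  obtain ⟨l, q, r⟩ := s
  obtain ⟨i, _ | _⟩ := p <;> obtain _ | _ | ⟨_ | _⟩ := q <;>
    grind [Slice.across, Piece.src, Piece.tgt]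

theorem Slice.across_eq_self_iff {s : Slice} {p : ℕ × Bool} :
    s.across p = p ↔ (∃ t, s.piece = .cross (.real t)) ∧ (p.1 = s.left ∨ p.1 = s.left + 1) := by
  obtain ⟨l, q, r⟩ := s
  obtain ⟨i, _ | _⟩ := p <;> obtain _ | _ | ⟨_ | _⟩ := q <;>
    grind [Slice.across, Piece.src, Piece.tgt]

/-- The colour of a port: whether the coloured side is on the left of the strand, seen in the
direction pointing out of the slice. -/
def portColour (c : ℕ → ℕ → Bool) (k : ℕ) : ℕ × Bool → Bool
  | (i, true) => !c k i
  | (i, false) => c (k + 1) i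

/-- The outward directions at the two ports of one strand are opposite, so a side that is carried
along the strand is on the left at exactly one of them. -/
theorem ColoursSlice.portColour_across {c : ℕ → ℕ → Bool} {k : ℕ} {s : Slice}
    (h : ColoursSlice c k s) {p : ℕ × Bool} (hp : s.IsPort p) (hne : s.across p ≠ p) :
    portColour c k (s.across p) = !portColour c k p := by
  obtain ⟨l, q, r⟩ := s
  obtain ⟨h1, h2, h3⟩ := h
  have h2' : ∀ i, l + q.tgt ≤ i → i < l + q.tgt + r →
      c (k + 1) i = c k (i - q.tgt + q.src) := by
    intro i hi hi'
    have := h2 (i - (l + q.tgt)) (by simp only; omega)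
    simp only at this
    rw [show l + q.tgt + (i - (l + q.tgt)) = i by omega] at this
    rw [this]; congr 1; omega
  have h2'' : ∀ i, l + q.src ≤ i → i < l + q.src + r →
      c (k + 1) (i - q.src + q.tgt) = c k i := by
    intro i hi hi'
    have := h2 (i - (l + q.src)) (by simp only; omega)
    simp only at this
    rw [show l + q.src + (i - (l + q.src)) = i by omega] at this
    rw [← this]; congr 1; omega
  simp only at h1
  obtain ⟨i, _ | _⟩ := p <;> simp only [Slice.IsPort, Slice.src, Slice.tgt] at hp <;>
    simp only [Slice.across] at hne ⊢
  · by_cases a : i < l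
    · simp [a, portColour, h1 i a]
    by_cases b : i < l + q.tgt
    · simp only [a, b, if_true, if_false] at hne ⊢
      obtain _ | _ | ⟨_ | _⟩ := q <;> simp only [Piece.tgt] at *
      · by_cases e : i = l
        · subst e; revert h3; simp [portColour]; cases c (k+1) i <;> cases c (k+1) (i+1) <;> simp
        · have e' : i = l + 1 := by omega
          subst e'; simp [portColour, Bool.eq_not.2 h3]
      · omega
      · exact absurd rfl hne
      · by_cases e : i = l
        · subst e; simp [portColour, h3.2]
        · have e' : i = l + 1 := by omega
          subst e'; simp [portColour, h3.1]
    · simp only [a, b, if_false, portColour, h2' i (by omega) (by omega)]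
  · by_cases a : i < l
    · simp [a, portColour, h1 i a]
    by_cases b : i < l + q.src
    · simp only [a, b, if_true, if_false] at hne ⊢
      obtain _ | _ | ⟨_ | _⟩ := q <;> simp only [Piece.src] at *
      · omega
      · by_cases e : i = l
        · subst e; revert h3; simp [portColour]; cases c k i <;> cases c k (i+1) <;> simp
        · have e' : i = l + 1 := by omega
          subst e'; simp [portColour, Bool.eq_not.2 h3]
      · exact absurd rfl hne
      · by_cases e : i = l
        · subst e; simp [portColour, h3.1]
        · have e' : i = l + 1 := by omega
          subst e'; simp [portColour, h3.2]
    · simp only [a, b, if_false, portColour, h2'' i (by omega) (by omega), Bool.not_not]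

theorem coloursSlice_of_portColour {c : ℕ → ℕ → Bool} {k : ℕ} {s : Slice}
    (h : ∀ p, s.IsPort p → s.across p ≠ p → portColour c k (s.across p) = !portColour c k p)
    (hreal : ∀ t, s.piece = .cross (.real t) → c k s.left ≠ c k (s.left + 1) ∧
      c (k + 1) s.left = c k s.left ∧ c (k + 1) (s.left + 1) = c k (s.left + 1)) :
    ColoursSlice c k s := by
  obtain ⟨l, q, r⟩ := s
  simp only [Slice.IsPort, Slice.src, Slice.tgt] at h hreal
  refine ⟨fun i hi => ?_, fun j hj => ?_, ?_⟩
  · simp only at hi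
    have := h (i, true) (by simp only; omega)
    simpa [Slice.across, hi, portColour] using this
  · simp only at hj ⊢
    have := h (l + q.src + j, true) (by simp only; omega)
    simp only [Slice.across, show ¬ l + q.src + j < l by omega,
      show ¬ l + q.src + j < l + q.src by omega, if_false, portColour, Bool.not_not] at this
    rw [← this (by simp)]; congr 1; omega
  · obtain _ | _ | ⟨_ | _⟩ := q <;> simp only [Piece.src, Piece.tgt] at *
    · have := h (l, false) (by simp only; omega)
      simp [Slice.across, Piece.tgt, portColour] at this
      simp [this]
    · have := h (l, true) (by simp only; omega)
      simp [Slice.across, Piece.src, portColour] at this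
      simp [this]
    · exact hreal _ rfl
    · have h1 := h (l, true) (by simp only; omega)
      have h2 := h (l + 1, true) (by simp only; omega)
      simp [Slice.across, Piece.src, portColour] at h1 h2
      exact ⟨h1, h2⟩

/-! ### Matching of consecutive slices. -/

theorem Stackable.src_head {m n : ℕ} {w : List Slice} {s : Slice} (h : Stackable m w n)
    (hs : w[0]? = some s) : s.src = m := by
  cases w with
  | nil => simp at hs
  | cons a w => simp at hs; subst hs; exact h.1

theorem Stackable.src_eq_tgt {m n : ℕ} {w : List Slice} {k : ℕ} {s t : Slice}
    (h : Stackable m w n) (hs : w[k]? = some s) (ht : w[k + 1]? = some t) : t.src = s.tgt := by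
  induction w generalizing m k with
  | nil => simp at hs
  | cons a w ih =>
    cases k with
    | zero => simp at hs ht; subst hs; exact h.2.src_head (by simpa using ht)
    | succ k => exact ih h.2 (by simpa using hs) (by simpa using ht)

theorem Stackable.tgt_last {m n : ℕ} {w : List Slice} {k : ℕ} {s : Slice}
    (h : Stackable m w n) (hs : w[k]? = some s) (ht : w[k + 1]? = none) : s.tgt = n := by
  induction w generalizing m k with
  | nil => simp at hs
  | cons a w ih =>
    cases k with
    | zero =>
      simp at hs ht; subst hs; subst ht; exact h.2
    | succ k => exact ih h.2 (by simpa using hs) (by simpa using ht)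

/-- A place of a diagram together with one of the two slices that meet there, the one above if
`port.2 = true` and the one below otherwise. -/
structure Diagram.Port (D : Diagram) where
  level : ℕ
  slice : Slice
  get : D.word[level]? = some slice
  port : ℕ × Bool
  isPort : slice.IsPort port

/-! ### The two involutions on the ports of a diagram. -/

namespace Diagram

variable {D : Diagram}

/-- The position of a port in a diagram. -/
def Port.place (p : D.Port) : ℕ × ℕ := (if p.port.2 then p.level else p.level + 1, p.port.1)

theorem Port.ext_port {p q : D.Port} (h : p.level = q.level) (h' : p.port = q.port) : p = q := by
  obtain ⟨k, s, hs, x, hx⟩ := p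
  obtain ⟨k', s', hs', x', hx'⟩ := q
  simp only at h h'
  subst h h'
  obtain rfl : s = s' := by rw [hs] at hs'; exact Option.some.inj hs'
  rfl

theorem Port.ext_place {p q : D.Port} (h : p.place = q.place) (h' : p.port.2 = q.port.2) :
    p = q := by
  simp only [Port.place, h', Prod.mk.injEq] at h
  refine Port.ext_port ?_ (Prod.ext h.2 h')
  have := h.1
  split_ifs at this <;> omega

/-- No strand meets the bottom or the top line of a closed diagram, so each place on a strand has a
slice on either side. -/
theorem Port.exists_turn (p : D.Port) : ∃ q : D.Port, q.place = p.place ∧ q.port.2 = !p.port.2 := by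
  obtain ⟨k, s, hs, ⟨i, _ | _⟩, hp⟩ := p <;> simp only [Slice.IsPort] at hp
  · cases ht : D.word[k + 1]? with
    | none => have := D.closed.tgt_last hs ht; omega
    | some t =>
      refine ⟨⟨k + 1, t, ht, (i, true), ?_⟩, rfl, rfl⟩
      simp only [Slice.IsPort]; rw [D.closed.src_eq_tgt hs ht]; exact hp
  · cases k with
    | zero => have := D.closed.src_head hs; omega
    | succ k =>
      cases ht : D.word[k]? with
      | none => simp at ht; have := (List.getElem?_eq_some_iff.1 hs).1; omega
      | some t =>
        refine ⟨⟨k, t, ht, (i, false), ?_⟩, rfl, rfl⟩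
        simp only [Slice.IsPort]; rw [← D.closed.src_eq_tgt ht hs]; exact hp

/-- The other port at the same place. -/
noncomputable def Port.turn (p : D.Port) : D.Port := p.exists_turn.choose

theorem Port.place_turn (p : D.Port) : p.turn.place = p.place := p.exists_turn.choose_spec.1

theorem Port.turn_up (p : D.Port) : p.turn.port.2 = !p.port.2 := p.exists_turn.choose_spec.2

theorem Port.turn_turn : Function.Involutive (Port.turn (D := D)) := fun p =>
  Port.ext_place (by rw [place_turn, place_turn]) (by rw [turn_up, turn_up, Bool.not_not])

theorem Port.turn_ne (p : D.Port) : p.turn ≠ p := fun h => by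
  have := p.turn_up
  rw [h] at this
  simp at this

theorem Port.eq_or_eq_turn {p q : D.Port} (h : p.place = q.place) : p = q ∨ p = q.turn := by
  by_cases e : p.port.2 = q.port.2
  · exact Or.inl (Port.ext_place h e)
  · refine Or.inr (Port.ext_place (by rw [place_turn, h]) ?_)
    rw [turn_up]; exact Bool.eq_not.2 e

/-- The other port of the strand of the slice; a port at a real crossing is left fixed. -/
def Port.across (p : D.Port) : D.Port where
  level := p.level
  slice := p.slice
  get := p.get
  port := p.slice.across p.port
  isPort := Slice.isPort_across p.isPort

theorem Port.across_across : Function.Involutive (Port.across (D := D)) := fun p =>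
  Port.ext_port rfl (p.slice.across_across p.port)

theorem Port.across_eq_self_iff {p : D.Port} :
    p.across = p ↔ p.slice.across p.port = p.port :=
  ⟨fun h => congrArg Port.port h, fun h => Port.ext_port rfl h⟩

instance : Finite D.Port := by
  let f : D.Port → Σ k : Fin D.word.length, Fin (D.word[k].src + D.word[k].tgt) × Bool := fun p =>
    ⟨⟨p.level, (List.getElem?_eq_some_iff.1 p.get).1⟩, ⟨p.port.1, by
      have h := (List.getElem?_eq_some_iff.1 p.get).2
      have h' := p.isPort
      obtain ⟨k, s, hs, ⟨i, _ | _⟩, hp⟩ := p <;> simp only [Slice.IsPort] at h' <;>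
        simp only at h <;> simp only [Fin.getElem_fin, h] <;> omega⟩, p.port.2⟩
  refine Finite.of_injective f fun p q h => ?_
  have h0 : p.level = q.level := congrArg (fun a => a.1.1) h
  have h1 : p.port.1 = q.port.1 := congrArg (fun a => a.2.1.1) h
  have h2 : p.port.2 = q.port.2 := congrArg (fun a => a.2.2) h
  exact Port.ext_port h0 (Prod.ext h1 h2)

/-! ### Arcs as orbits of `across` and `turn`. -/

theorem Port.exists_of_linked {x y : ℕ × ℕ} (h : D.Linked x y) :
    ∃ p : D.Port, p.place = x ∧ p.across.place = y := by
  cases h with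
  | @left k s i h hi =>
    refine ⟨⟨k, s, h, (i, true), ?_⟩, rfl, ?_⟩
    · simp only [Slice.IsPort, Slice.src]; omega
    · simp [Port.place, Port.across, Slice.across, hi]
  | @right k s j h hj =>
    refine ⟨⟨k, s, h, (s.left + s.piece.src + j, true), ?_⟩, rfl, ?_⟩
    · simp only [Slice.IsPort, Slice.src]; omega
    · simp only [Port.place, Port.across, Slice.across, if_neg (show ¬ s.left + s.piece.src + j <
        s.left by omega), if_neg (show ¬ s.left + s.piece.src + j < s.left + s.piece.src by omega)]
      simp; omega
  | cup h =>
    refine ⟨⟨_, _, h, (_, false), ?_⟩, rfl, ?_⟩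
    · simp only [Slice.IsPort, Slice.tgt, Piece.tgt]; omega
    · simp [Port.place, Port.across, Slice.across, Piece.tgt]
  | cap h =>
    refine ⟨⟨_, _, h, (_, true), ?_⟩, rfl, ?_⟩
    · simp only [Slice.IsPort, Slice.src, Piece.src]; omega
    · simp [Port.place, Port.across, Slice.across, Piece.src]
  | virt h =>
    refine ⟨⟨_, _, h, (_, true), ?_⟩, rfl, ?_⟩
    · simp only [Slice.IsPort, Slice.src, Piece.src]; omega
    · simp [Port.place, Port.across, Slice.across, Piece.src]
  | virt' h =>
    refine ⟨⟨_, _, h, (_, true), ?_⟩, rfl, ?_⟩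
    · simp only [Slice.IsPort, Slice.src, Piece.src]; omega
    · simp [Port.place, Port.across, Slice.across, Piece.src]

theorem Port.arc_across (p : D.Port) : D.arc p.across.place = D.arc p.place := by
  obtain ⟨k, ⟨l, q, r⟩, hs, ⟨i, b⟩, hi⟩ := p
  have hL (hi : i < l) : D.arc (k, i) = D.arc (k + 1, i) := Quot.sound (Linked.left hs hi)
  have hR (j : ℕ) (hj : j < r) : D.arc (k, l + q.src + j) = D.arc (k + 1, l + q.tgt + j) :=
    Quot.sound (Linked.right hs hj)
  have hsrc (h : l + q.src ≤ i) (h' : i < l + q.src + r) :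
      D.arc (k, i) = D.arc (k + 1, i - q.src + q.tgt) := by
    have := hR (i - (l + q.src)) (by omega)
    rwa [show l + q.src + (i - (l + q.src)) = i by omega,
      show l + q.tgt + (i - (l + q.src)) = i - q.src + q.tgt by omega] at this
  have htgt (h : l + q.tgt ≤ i) (h' : i < l + q.tgt + r) :
      D.arc (k, i - q.tgt + q.src) = D.arc (k + 1, i) := by
    have := hR (i - (l + q.tgt)) (by omega)
    rwa [show l + q.tgt + (i - (l + q.tgt)) = i by omega,
      show l + q.src + (i - (l + q.tgt)) = i - q.tgt + q.src by omega] at this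
  simp only [Port.place, Port.across]
  clear hR
  obtain _ | _ | ⟨_ | _⟩ := q
  · have := Quot.sound (Linked.cup hs)
    change D.arc _ = D.arc _ at this
    cases b <;> grind [Slice.IsPort, Slice.across, Slice.src, Slice.tgt, Piece.src, Piece.tgt]
  · have := Quot.sound (Linked.cap hs)
    change D.arc _ = D.arc _ at this
    cases b <;> grind [Slice.IsPort, Slice.across, Slice.src, Slice.tgt, Piece.src, Piece.tgt]
  · cases b <;> grind [Slice.IsPort, Slice.across, Slice.src, Slice.tgt, Piece.src, Piece.tgt]
  · have h1 := Quot.sound (Linked.virt hs)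
    have h2 := Quot.sound (Linked.virt' hs)
    change D.arc _ = D.arc _ at h1 h2
    cases b <;> grind [Slice.IsPort, Slice.across, Slice.src, Slice.tgt, Piece.src, Piece.tgt]

theorem Port.arc_eq_iff {p q : D.Port} : D.arc p.place = D.arc q.place ↔
    Relation.ReflTransGen (fun a b : D.Port => b = a.across ∨ b = a.turn) p q := by
  constructor
  · intro h
    let R := Relation.ReflTransGen (fun a b : D.Port => b = a.across ∨ b = a.turn) p
    have ha : ∀ {a}, R a → R a.across := fun h => h.tail (Or.inl rfl)
    have ht : ∀ {a}, R a → R a.turn := fun h => h.tail (Or.inr rfl)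
    have same : ∀ {a b : D.Port}, a.place = b.place → R b → R a := by
      intro a b e hb
      rcases Port.eq_or_eq_turn e with rfl | rfl
      exacts [hb, ht hb]
    -- Reachability from `p` is constant along links and so descends to the quotient that defines
    -- arcs.
    have hP : ∀ x y, D.Linked x y →
        (∃ a : D.Port, a.place = x ∧ R a) = (∃ a : D.Port, a.place = y ∧ R a) := by
      intro x y hxy
      obtain ⟨b, rfl, rfl⟩ := Port.exists_of_linked hxy
      refine propext ⟨?_, ?_⟩
      · rintro ⟨a, e, h⟩
        exact ⟨_, rfl, ha (same e.symm h)⟩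
      · rintro ⟨a, e, h⟩
        have := ha (same e.symm h)
        rw [Port.across_across] at this
        exact ⟨_, rfl, this⟩
    have := congrArg (Quot.lift _ hP) h
    obtain ⟨a, e, h⟩ := (iff_of_eq this).1 ⟨p, rfl, .refl⟩
    exact same e.symm h
  · intro h
    induction h with
    | refl => rfl
    | tail _ h ih =>
      rcases h with rfl | rfl
      · rw [ih, Port.arc_across]
      · rw [ih, Port.place_turn]

/-! ### Ends at real crossings as the fixed points of `across`. -/

/-- The port at an end of a real crossing. -/
def RealCrossing.toPort (x : D.RealCrossing × Corner) : D.Port where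
  level := x.1.level
  slice := _
  get := x.1.get
  port := match x.2 with
    | .nw => (x.1.left, false)
    | .sw => (x.1.left, true)
    | .se => (x.1.left + 1, true)
    | .ne => (x.1.left + 1, false)
  isPort := by
    obtain ⟨x, _ | _⟩ := x <;>
      simp only [Slice.IsPort, Slice.src, Slice.tgt, Piece.src, Piece.tgt] <;> omega

theorem RealCrossing.place_toPort (x : D.RealCrossing × Corner) :
    (toPort x).place = x.1.place x.2 := by
  obtain ⟨x, _ | _⟩ := x <;> rfl

theorem RealCrossing.toPort_injective :
    Function.Injective (toPort (D := D)) := by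
  rintro ⟨x, a⟩ ⟨y, b⟩ h
  have h1 : x.level = y.level := congrArg Port.level h
  have h2 : (⟨x.left, _, x.right⟩ : Slice) = ⟨y.left, _, y.right⟩ := congrArg Port.slice h
  have h3 := congrArg Port.port h
  obtain ⟨k, l, t, r, hx⟩ := x
  obtain ⟨k', l', t', r', hy⟩ := y
  simp only [Slice.mk.injEq, Piece.cross.injEq, Crossing.real.injEq] at h1 h2
  obtain ⟨rfl, rfl, rfl⟩ := h2
  subst h1
  cases a <;> cases b <;> simp [toPort] at h3 <;> rfl

theorem RealCrossing.across_toPort (x : D.RealCrossing × Corner) :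
    (toPort x).across = toPort x := by
  rw [Port.across_eq_self_iff, Slice.across_eq_self_iff]
  refine ⟨⟨_, rfl⟩, ?_⟩
  obtain ⟨x, _ | _⟩ := x <;> simp [toPort]

theorem RealCrossing.exists_toPort_eq {p : D.Port} (h : p.across = p) :
    ∃ x, toPort x = p := by
  rw [Port.across_eq_self_iff, Slice.across_eq_self_iff] at h
  obtain ⟨k, ⟨l, q, r⟩, hs, ⟨i, b⟩, hi⟩ := p
  obtain ⟨⟨t, ht⟩, hi'⟩ := h
  simp only at ht hi'
  subst ht
  let x : D.RealCrossing := ⟨k, l, t, r, hs⟩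
  rcases hi' with rfl | rfl <;> cases b
  · exact ⟨(x, .nw), rfl⟩
  · exact ⟨(x, .sw), rfl⟩
  · exact ⟨(x, .ne), rfl⟩
  · exact ⟨(x, .se), rfl⟩

end Diagram

theorem Corner.rot_rot_rot_rot (q : Corner) : q.rot.rot.rot.rot = q := by cases q <;> rfl

theorem Corner.rot_rot_ne (q : Corner) : q.rot.rot ≠ q := by cases q <;> simp [Corner.rot]

namespace Diagram

variable {D : Diagram}

theorem surface_join_iff {x y : D.RealCrossing × Corner} :
    D.surface.join x y ↔ x ≠ y ∧
      Relation.ReflTransGen (fun a b : D.Port => b = a.across ∨ b = a.turn)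
        (RealCrossing.toPort x) (RealCrossing.toPort y) := by
  rw [← Port.arc_eq_iff, RealCrossing.place_toPort, RealCrossing.place_toPort]
  rfl

theorem surface_join_symm {x y : D.RealCrossing × Corner} (h : D.surface.join x y) :
    D.surface.join y x := ⟨h.1.symm, h.2.symm⟩

instance : Finite (D.RealCrossing × Corner) :=
  Finite.of_injective _ RealCrossing.toPort_injective

instance : Finite D.surface.Loop := by
  have : (Set.range fun p : D.Port => D.arc p.place).Finite := Set.finite_range _
  have h : {a | (∃ p, D.IsPlace p ∧ D.arc p = a) ∧
      ∀ (x : D.RealCrossing) (q : Corner), D.arc (x.place q) ≠ a}.Finite := by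
    refine this.subset ?_
    rintro a ⟨⟨⟨k, i⟩, ⟨s, hs, hi⟩, rfl⟩, -⟩
    exact ⟨⟨k, s, hs, (i, true), hi⟩, rfl⟩
  exact h.to_subtype

/-! ### Checkerboard colourings and alternating colourings of ends. -/

/-- A colouring of the ends of arcs at the real crossings that alternates around each crossing and
takes different values at the two ends of an arc. -/
structure AlternatesOnEnds (C : D.RealCrossing × Corner → Bool) : Prop where
  rot : ∀ x q, C (x, q.rot) = !C (x, q)
  join : ∀ x y, D.surface.join x y → C y = !C x

theorem exists_alternating_of_colorable (h : D.CheckerboardColorable) :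
    ∃ C : D.RealCrossing × Corner → Bool, AlternatesOnEnds C ∧
      ∀ x : D.RealCrossing × Corner, ∃! y : D.RealCrossing × Corner, D.surface.join x y := by
  obtain ⟨c, hc⟩ := h
  let C : D.Port → Bool := fun p => portColour c p.level p.port
  have hC' : ∀ p : D.Port, C p = if p.port.2 then !c p.place.1 p.place.2
      else c p.place.1 p.place.2 := by
    rintro ⟨k, s, hs, ⟨i, _ | _⟩, hp⟩ <;> rfl
  have hturn : ∀ p : D.Port, C p.turn = !C p := by
    intro p
    rw [hC', hC', Port.place_turn, Port.turn_up]
    cases p.port.2 <;> simp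
  have hacross : ∀ p : D.Port, p.across ≠ p → C p.across = !C p := fun p hp =>
    (hc _ _ p.get).portColour_across p.isPort (fun e => hp (Port.across_eq_self_iff.2 e))
  have mate : ∀ x : D.RealCrossing × Corner, ∃ y, D.surface.join x y ∧
      C (RealCrossing.toPort y) = !C (RealCrossing.toPort x) ∧ ∀ z, D.surface.join x z → z = y := by
    intro x
    obtain ⟨p, hxp, hp, hCp, huniq⟩ := exists_opposite_fixed Port.across_across Port.turn_turn
      hturn hacross (RealCrossing.across_toPort x)
    obtain ⟨y, rfl⟩ := RealCrossing.exists_toPort_eq hp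
    refine ⟨y, surface_join_iff.2 ⟨?_, hxp⟩, hCp, fun z hz => ?_⟩
    · rintro rfl
      simp at hCp
    · obtain ⟨hne, hz⟩ := surface_join_iff.1 hz
      rcases huniq _ hz (RealCrossing.across_toPort z) with e | e
      · exact absurd (RealCrossing.toPort_injective e).symm hne
      · exact RealCrossing.toPort_injective e
  refine ⟨fun x => C (RealCrossing.toPort x), ⟨fun x q => ?_, fun x y hxy => ?_⟩, fun x => ?_⟩
  -- The port colours negate `c` on the bottom line only, which turns the condition at a real
  -- crossing into alternation around it.
  · obtain ⟨h1, h2, h3⟩ := (hc _ _ x.get).2.2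
    have h4 := Bool.eq_not.2 h1
    cases q <;> simp [C, RealCrossing.toPort, portColour, Corner.rot, h2, h3, h4]
  · obtain ⟨z, -, hz, hz'⟩ := mate x
    rw [hz' y hxy]; exact hz
  · obtain ⟨y, hy, -, hy'⟩ := mate x
    exact ⟨y, hy, hy'⟩

/-- An alternating colouring of all ports is chosen arbitrarily and then reversed on those arcs
where it disagrees with `C`. -/
theorem colorable_of_alternating {C : D.RealCrossing × Corner → Bool} (hC : AlternatesOnEnds C)
    (hmate : ∀ x : D.RealCrossing × Corner, ∃! y : D.RealCrossing × Corner,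
      D.surface.join x y) : D.CheckerboardColorable := by
  classical
  choose m hm hm' using hmate
  simp only at hm hm'
  have hmm : ∀ x, m (m x) = x := fun x => (hm' _ _ (surface_join_symm (hm x))).symm
  choose e he using fun p : {p : D.Port // p.across = p} => RealCrossing.exists_toPort_eq p.2
  have he' : ∀ x h, e ⟨RealCrossing.toPort x, h⟩ = x := fun x h =>
    RealCrossing.toPort_injective (he _)
  -- At an end of an arc, jumping to the other end replaces the fixed point of `across`; the
  -- resulting involution has no fixed points.
  let σ : D.Port → D.Port := fun p =>
    if h : p.across = p then RealCrossing.toPort (m (e ⟨p, h⟩)) else p.across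
  have σ_end : ∀ x, σ (RealCrossing.toPort x) = RealCrossing.toPort (m x) := by
    intro x
    simp only [σ, dif_pos (RealCrossing.across_toPort x), he']
  have σ_ne : ∀ p : D.Port, p.across ≠ p → σ p = p.across := fun p h => dif_neg h
  have hσ : Function.Involutive σ := by
    intro p
    by_cases h : p.across = p
    · obtain ⟨x, rfl⟩ := RealCrossing.exists_toPort_eq h
      rw [σ_end, σ_end, hmm]
    · rw [σ_ne p h, σ_ne, Port.across_across]
      rw [Port.across_across]; exact Ne.symm h
  have hσ' : ∀ p, σ p ≠ p := by
    intro p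
    by_cases h : p.across = p
    · obtain ⟨x, rfl⟩ := RealCrossing.exists_toPort_eq h
      rw [σ_end]
      exact fun e => (hm x).1 (RealCrossing.toPort_injective e).symm
    · rwa [σ_ne p h]
  obtain ⟨O, hOt, hOσ⟩ := exists_alternating_of_involutive hσ Port.turn_turn hσ' Port.turn_ne
  -- On each arc, `O` and `C` agree at both ends or at none.
  let P : Quot D.Linked → Prop := fun a => ∃ x : D.RealCrossing × Corner,
    D.arc (x.1.place x.2) = a ∧ O (RealCrossing.toPort x) ≠ C x
  let F : D.Port → Bool := fun p => xor (O p) (decide (P (D.arc p.place)))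
  have F_end : ∀ x, F (RealCrossing.toPort x) = C x := by
    intro x
    have : P (D.arc (RealCrossing.toPort x).place) ↔ O (RealCrossing.toPort x) ≠ C x := by
      rw [RealCrossing.place_toPort]
      refine ⟨?_, fun h => ⟨x, rfl, h⟩⟩
      rintro ⟨y, hy, hne⟩
      by_cases e : x = y
      · rwa [e]
      · have hj : D.surface.join x y := ⟨e, hy.symm⟩
        rw [hm' x y hj, ← σ_end, hOσ, hC.join x _ (hm x)] at hne
        intro h; exact hne (by rw [h])
    simp only [F, this]
    cases O (RealCrossing.toPort x) <;> cases C x <;> simp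
  have F_turn : ∀ p, F p.turn = !F p := by
    intro p
    simp only [F, hOt, Port.place_turn, Bool.not_xor]
  have F_across : ∀ p : D.Port, p.across ≠ p → F p.across = !F p := by
    intro p hp
    simp only [F, Port.arc_across, ← Bool.not_xor, ← hOσ, σ_ne p hp]
  -- The colour is read from the port of the slice above; the value `false` occurs only off the
  -- diagram.
  let c : ℕ → ℕ → Bool := fun k i =>
    if h : ∃ p : D.Port, p.place = (k, i) ∧ p.port.2 = true then !F h.choose else false
  have c_place : ∀ p : D.Port, p.port.2 = true → c p.place.1 p.place.2 = !F p := by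
    intro p hp
    have h : ∃ q : D.Port, q.place = (p.place.1, p.place.2) ∧ q.port.2 = true := ⟨p, rfl, hp⟩
    simp only [c, dif_pos h]
    rw [Port.ext_place h.choose_spec.1 (h.choose_spec.2.trans hp.symm)]
  have c_port : ∀ p : D.Port, portColour c p.level p.port = F p := by
    intro p
    by_cases hp : p.port.2 = true
    · have := c_place p hp
      obtain ⟨k, s, hs, ⟨i, _ | _⟩, hi⟩ := p
      · simp at hp
      · simp only [Port.place, if_true] at this
        simp [portColour, this]
    · have := c_place p.turn (by rw [Port.turn_up]; simpa using hp)
      rw [Port.place_turn, F_turn, Bool.not_not] at this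
      obtain ⟨k, s, hs, ⟨i, _ | _⟩, hi⟩ := p
      · exact this
      · simp at hp
  refine ⟨c, fun k s hs => coloursSlice_of_portColour (fun p hp hne => ?_) fun t ht => ?_⟩
  · let p' : D.Port := ⟨k, s, hs, p, hp⟩
    have h := F_across p' (fun e => hne (Port.across_eq_self_iff.1 e))
    rw [← c_port, ← c_port] at h
    exact h
  · obtain ⟨l, q, r⟩ := s
    simp only at ht ⊢
    subst ht
    let x : D.RealCrossing := ⟨k, l, t, r, hs⟩
    have key : ∀ q, portColour c k (RealCrossing.toPort (x, q)).port = C (x, q) := fun q =>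
      (c_port _).trans (F_end _)
    have h1 := key .nw
    have h2 := key .sw
    have h3 := key .se
    have h4 := key .ne
    have r1 := hC.rot x .nw
    have r2 := hC.rot x .sw
    have r3 := hC.rot x .se
    simp only [Corner.rot] at r1 r2 r3
    simp only [RealCrossing.toPort, portColour, x] at h1 h2 h3 h4
    rw [h1, h4, ← Bool.not_not (c k l), ← Bool.not_not (c k (l + 1)), h2, h3, r3, r2, r1]
    simp [x]

/-! ### Colourings and associated graphs. -/

theorem RealCrossing.isOver_rot (x : D.RealCrossing) (q : Corner) :
    x.IsOver q.rot ↔ ¬ x.IsOver q := by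
  cases q <;> simp [IsOver, Corner.rot]

/-- In the medial diagram the Boolean of `(h, b)` alternates under rotation and changes along arcs;
partners are unique because `next` is a permutation. -/
theorem colorable_of_isAssociatedWith {G : SignedCyclicGraph} (h : D.IsAssociatedWith G) :
    D.CheckerboardColorable := by
  obtain ⟨φ⟩ := h
  let f : G.H × Bool ≃ D.RealCrossing × Corner := φ.ends
  have f_rot : ∀ a, f (G.medial.rot a) = ((f a).1, (f a).2.rot) := φ.map_rot
  have f_join : ∀ a b, D.surface.join (f a) (f b) ↔ G.medial.join a b := φ.map_join
  refine colorable_of_alternating (C := fun x => (f.symm x).2) ⟨fun x q => ?_, ?_⟩ fun x => ?_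
  · obtain ⟨⟨h, b⟩, e⟩ := f.surjective (x, q)
    have := f_rot (h, b)
    rw [e] at this
    change (f.symm ((x, q).1, (x, q).2.rot)).2 = _
    rw [← this, ← e, f.symm_apply_apply]
    refine (congrArg Prod.snd (f.symm_apply_apply (G.medial.rot (h, b)))).trans ?_
    cases b <;> rfl
  · intro x y hxy
    obtain ⟨a, rfl⟩ := f.surjective x
    obtain ⟨b, rfl⟩ := f.surjective y
    rw [f.symm_apply_apply, f.symm_apply_apply]
    obtain ⟨h, ⟨rfl, rfl⟩ | ⟨rfl, rfl⟩⟩ := (f_join a b).1 hxy <;> rfl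
  · obtain ⟨⟨h, b⟩, rfl⟩ := f.surjective x
    cases b
    · refine ⟨f (G.next⁻¹ h, true), (f_join _ _).2 ⟨G.next⁻¹ h, Or.inr ⟨rfl, by simp⟩⟩, ?_⟩
      intro y hy
      obtain ⟨b, rfl⟩ := f.surjective y
      obtain ⟨g, ⟨e, -⟩ | ⟨rfl, e⟩⟩ := (f_join _ _).1 hy
      · simp at e
      · simp only [Prod.mk.injEq, and_true] at e
        simp [e]
    · refine ⟨f (G.next h, false), (f_join _ _).2 ⟨h, Or.inl ⟨rfl, rfl⟩⟩, ?_⟩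
      intro y hy
      obtain ⟨b, rfl⟩ := f.surjective y
      obtain ⟨g, ⟨e, rfl⟩ | ⟨-, e⟩⟩ := (f_join _ _).1 hy
      · simp only [Prod.mk.injEq, and_true] at e
        simp [e]
      · simp at e

/-- The next end counterclockwise around the same real crossing. -/
def rotEnd : Equiv.Perm (D.RealCrossing × Corner) where
  toFun x := (x.1, x.2.rot)
  invFun x := (x.1, x.2.rot.rot.rot)
  left_inv x := by simp [Corner.rot_rot_rot_rot]
  right_inv x := by simp [Corner.rot_rot_rot_rot]

theorem rotEnd_four (x : D.RealCrossing × Corner) :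
    rotEnd (rotEnd (rotEnd (rotEnd x))) = x := by
  simp [rotEnd, Corner.rot_rot_rot_rot]

/-- The coloured quadrants become half-edges, the two at one crossing forming an edge. Vertices are
the cycles met when following arcs along the coloured side, together with one isolated vertex for
each closed component without real crossings. -/
theorem exists_isAssociatedWith_of_alternating {C : D.RealCrossing × Corner → Bool}
    (hC : AlternatesOnEnds C) (hmate : ∀ x : D.RealCrossing × Corner, ∃! y : D.RealCrossing × Corner,
      D.surface.join x y) :
    ∃ G, D.IsAssociatedWith G := by
  classical
  choose m hm hm' using hmate
  simp only at hm hm'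
  have hmm : ∀ x, m (m x) = x := fun x => (hm' _ _ (surface_join_symm (hm x))).symm
  have Cm : ∀ x, C (m x) = !C x := fun x => hC.join _ _ (hm x)
  have Cr : ∀ x, C (rotEnd x) = !C x := fun x => hC.rot x.1 x.2
  have Cr' : ∀ x, C (rotEnd.symm x) = !C x := fun x => by
    have := Cr (rotEnd.symm x)
    rw [Equiv.apply_symm_apply] at this
    rw [this, Bool.not_not]
  let H := {x : D.RealCrossing × Corner // C x = true}
  -- The arc leaving `h` arrives at the clockwise side `(next h, false)`, which is one rotation past
  -- the end representing `next h`; hence the inverse rotation.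
  let next : Equiv.Perm H :=
    { toFun := fun h => ⟨rotEnd.symm (m h), by rw [Cr', Cm, Bool.not_not, h.2]⟩
      invFun := fun h => ⟨m (rotEnd h), by rw [Cm, Cr, Bool.not_not, h.2]⟩
      left_inv := fun h => Subtype.ext (by simp [hmm])
      right_inv := fun h => Subtype.ext (by simp [hmm]) }
  have over_rot : ∀ x : D.RealCrossing × Corner,
      (rotEnd x).1.IsOver (rotEnd x).2 ↔ ¬ x.1.IsOver x.2 := fun x => x.1.isOver_rot x.2
  let G : SignedCyclicGraph :=
    { V := Quotient (Equiv.Perm.SameCycle.setoid next) ⊕ D.surface.Loop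
      H := H
      finite_V := inferInstance
      finite_H := inferInstance
      root := fun h => Sum.inl (Quotient.mk _ h)
      flip := fun h => ⟨rotEnd (rotEnd h), by rw [Cr, Cr, Bool.not_not, h.2]⟩
      flip_flip := fun h => Subtype.ext (rotEnd_four _)
      flip_ne := fun h e => Corner.rot_rot_ne h.1.2 (congrArg (fun a : H => a.1.2) e)
      next := next
      sameCycle_iff := fun h h' =>
        (Quotient.eq (r := Equiv.Perm.SameCycle.setoid next)).symm.trans Sum.inl_injective.eq_iff.symm
      -- In the medial diagram `(h, true)` is an over end exactly for a positive edge.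
      sign := fun h => decide (h.1.1.IsOver h.1.2)
      sign_flip := fun h => by simp only [over_rot, not_not] }
  let ends : H × Bool ≃ D.RealCrossing × Corner :=
    { toFun := fun a => if a.2 then a.1.1 else rotEnd a.1.1
      invFun := fun x => if h : C x = true then (⟨x, h⟩, true)
        else (⟨rotEnd.symm x, by rw [Cr']; simpa using h⟩, false)
      left_inv := by
        rintro ⟨⟨x, hx⟩, _ | _⟩
        · simp [Cr, hx]
        · simp [hx]
      right_inv := by
        intro x
        by_cases h : C x = true <;> simp [h] }
  have ends_true : ∀ h : H, ends (h, true) = h.1 := fun h => rfl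
  have ends_false : ∀ h : H, ends (h, false) = rotEnd h.1 := fun h => rfl
  have ends_next : ∀ h : H, ends (next h, false) = m h := fun h =>
    rotEnd.apply_symm_apply _
  have join_iff : ∀ x y : D.RealCrossing × Corner, D.surface.join x y ↔ y = m x :=
    fun x y => ⟨hm' x y, fun e => e ▸ hm x⟩
  have map_join : ∀ a b : H × Bool, D.surface.join (ends a) (ends b) ↔ G.medial.join a b := by
    intro a b
    rw [join_iff]
    constructor
    · intro e
      obtain ⟨h, _ | _⟩ := a
      · have hb : C (ends b) = true := by rw [e, Cm, ends_false, Cr, h.2]; rfl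
        refine ⟨⟨ends b, hb⟩, Or.inr ⟨ends.injective ?_, ends.injective ?_⟩⟩
        · rw [ends_true]
        · rw [ends_next]; exact ((congrArg m e).trans (hmm _)).symm
      · refine ⟨h, Or.inl ⟨rfl, ends.injective ?_⟩⟩
        rw [ends_next]; exact e
    · rintro ⟨h, ⟨rfl, rfl⟩ | ⟨rfl, rfl⟩⟩
      · exact ends_next h
      · change ends (h, true) = m (ends (next h, false))
        rw [ends_next, hmm, ends_true]
  -- Each cycle of `next` contains a half-edge, so only the added vertices are isolated.
  let loops : {v : G.V // ∀ h, G.root h ≠ v} ≃ D.surface.Loop :=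
    { toFun := fun v => match v with
        | ⟨Sum.inr a, _⟩ => a
        | ⟨Sum.inl q, hq⟩ => (q.exists_rep.elim fun h e => hq h (congrArg Sum.inl e) : False).elim
      invFun := fun a => ⟨Sum.inr a, fun _ => Sum.inl_ne_inr⟩
      left_inv := by
        rintro ⟨q | a, hq⟩
        · exact (q.exists_rep.elim fun h e => hq h (congrArg Sum.inl e) : False).elim
        · rfl
      right_inv := fun a => rfl }
  refine ⟨G, ⟨⟨ends, loops, ?_, ?_, map_join⟩⟩⟩
  · rintro ⟨h, _ | _⟩ <;> rfl
  · rintro ⟨h, _ | _⟩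
    · change (rotEnd h.1).1.IsOver (rotEnd h.1).2 ↔ false = decide (h.1.1.IsOver h.1.2)
      rw [over_rot]; simp
    · change h.1.1.IsOver h.1.2 ↔ true = decide (h.1.1.IsOver h.1.2)
      simp

theorem colorable_iff_exists_isAssociatedWith :
    D.CheckerboardColorable ↔ ∃ G, D.IsAssociatedWith G := by
  constructor
  · intro h
    obtain ⟨C, hC, hmate⟩ := exists_alternating_of_colorable h
    exact exists_isAssociatedWith_of_alternating hC hmate
  · rintro ⟨G, h⟩
    exact colorable_of_isAssociatedWith h

end Diagram
end VirtualLinks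

theorem theorem3p3 (L : VirtualLinks.VirtualLink) :
    L.Graphical ↔ L.CheckerboardColorable := by
  constructor
  · rintro ⟨G, D, h, rfl⟩
    exact ⟨D, rfl, VirtualLinks.Diagram.colorable_of_isAssociatedWith h⟩
  · rintro ⟨D, rfl, h⟩
    obtain ⟨G, hG⟩ := VirtualLinks.Diagram.colorable_iff_exists_isAssociatedWith.1 h
    exact ⟨G, D, hG, rfl⟩
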